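/- For $k=(k_x,k_y,k_z)\in\mathbb R^3$ write $c_\alpha=\cos k_\alpha$, $s_\alpha=\sin k_\alpha$ and put $$\lambda(k)=c_xc_yc_z-s_xs_ys_z,\qquad n(k)=\begin{pmatrix}s_xc_yc_z+c_xs_ys_z\\ c_xs_yc_z-s_xc_ys_z\\ c_xc_ys_z+s_xs_yc_z\end{pmatrix}.$$ Let $L=\{\pi m: m\in\mathbb Z^3,\ m_1+m_2+m_3\ \text{even}\}$ be the reciprocal lattice of the body-centred cubic lattice generated by the vectors $(\pm1,\pm1,\pm1)$, and let $\mathsf B=\mathbb R^3/L$ be the Brillouin zone, a compact smooth $3$-manifold; equivalently, $\mathsf B$ is the rhombic dodecahedron $\{|k_i\pm k_j|\le\pi,\ i\ne j\}$ with boundary points that differ by a vector of $L$ identified. The functions $\lambda$, $\cos(2k_y)$ and the map $n$ are $L$-periodic, hence defined on $\mathsf B$. Let $\mathsf F=\{k\in\mathsf B:\lambda(k)=0\}\cup\{k\in\mathsf B:\cos(2k_y)=0\}$. Let $\mathsf U\subset\mathbb R^3$ be the open Euclidean unit ball, $e_\pm(t)=\tfrac1{\sqrt2}(\sin t,\cos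 t,\pm\sin t)$, $\mathsf T_1=(-\tfrac\pi2,\tfrac\pi2)$, $\mathsf T_2=(-\pi,-\tfrac\pi2)\cup(\tfrac\pi2,\pi]$, and $$\mathsf Q_a=\mathsf U\setminus\bigl(e_+(\mathsf T_1)\cup e_-(\mathsf T_2)\bigr),\qquad \mathsf Q_b=\mathsf U\setminus\bigl(e_+(\mathsf T_2)\cup e_-(\mathsf T_1)\bigr).$$ Then $\mathsf B\setminus\mathsf F$ has exactly four connected components, namely $$\begin{aligned} \mathsf B'_0&=\{k\in\mathsf B:\lambda(k)>0,\ \cos(2k_y)>0\}, & \mathsf B'_1&=\{k\in\mathsf B:\lambda(k)<0,\ \cos(2k_y)>0\},\\ \mathsf B'_2&=\{k\in\mathsf B:\lambda(k)>0,\ \cos(2k_y)<0\}, & \mathsf B'_3&=\{k\in\mathsf B:\lambda(k)<0,\ \cos(2k_y)<0\}. \end{aligned}$$ For each $i$, the set $n(\mathsf B'_i)$ is open in $\mathbb R^3$ and the restriction of $n$ to $\mathsf B'_i$ is a ($C^\infty$) diffeomorphism onto $n(\mathsf B'_i)$. Moreover $$n(\mathsf B'_0)=n(\mathsf B'_2)=\mathsf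 Q_a,\qquad n(\mathsf B'_1)=n(\mathsf B'_3)=\mathsf Q_b .$$ -/

import Mathlib

open Set Topology
open scoped Manifold ContDiff

noncomputable section

namespace WeylWalk

/-- Three-dimensional Euclidean space. -/
abbrev E3 : Type := EuclideanSpace ℝ (Fin 3)

/-! ### The Brillouin zone of the body-centred cubic lattice -/

/-- The reciprocal lattice of the body-centred cubic lattice generated by `(±1, ±1, ±1)`
(see `mem_reciprocalLattice_iff`): the vectors `π • m` with `m ∈ ℤ³` and `m₀ + m₁ + m₂` even. -/
def reciprocalLattice : AddSubgroup E3 where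
  carrier := {G | ∃ m : Fin 3 → ℤ, Even (m 0 + m 1 + m 2) ∧ ∀ i, G i = Real.pi * m i}
  zero_mem' := ⟨0, by simp, by simp⟩
  add_mem' := by
    rintro a b ⟨m, ⟨r, hm⟩, ha⟩ ⟨l, ⟨s, hl⟩, hb⟩
    refine ⟨m + l, ⟨r + s, ?_⟩, fun i => ?_⟩
    · simp only [Pi.add_apply]
      omega
    · simp only [PiLp.add_apply, ha i, hb i, Pi.add_apply]
      push_cast
      ring
  neg_mem' := by
    rintro a ⟨m, ⟨r, hm⟩, ha⟩
    refine ⟨-m, ⟨-r, ?_⟩, fun i => ?_⟩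
    · simp only [Pi.neg_apply]
      omega
    · simp [ha i]

/-- The reciprocal lattice consists of the vectors `G` with `G · h ∈ 2πℤ` for each of the
generators `h = (±1, ±1, ±1)` of the body-centred cubic lattice. -/
theorem mem_reciprocalLattice_iff (G : E3) :
    G ∈ reciprocalLattice ↔
      ∀ h : E3, (∀ i, h i = 1 ∨ h i = -1) → ∃ m : ℤ, inner ℝ G h = 2 * Real.pi * m := by
  have hin : ∀ h : E3, inner ℝ G h = G 0 * h 0 + G 1 * h 1 + G 2 * h 2 := by
    intro h
    simp [PiLp.inner_apply, Fin.sum_univ_three]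
    ring
  constructor
  · rintro ⟨m, ⟨r, hr⟩, hG⟩ h hh
    have hr' : (m 0 : ℝ) + m 1 + m 2 = r + r := by exact_mod_cast hr
    have key : ∀ i, ∃ s : ℤ, (h i) = 1 - 2 * s := by
      intro i
      rcases hh i with h1 | h1
      · exact ⟨0, by simp [h1]⟩
      · exact ⟨1, by rw [h1]; norm_num⟩
    choose s hs using key
    refine ⟨r - (m 0 * s 0 + m 1 * s 1 + m 2 * s 2), ?_⟩
    rw [hin, hs 0, hs 1, hs 2, hG 0, hG 1, hG 2]
    push_cast
    linear_combination Real.pi * hr'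
  · intro H
    obtain ⟨a, ha⟩ := H !₂[1, 1, 1] (by intro i; fin_cases i <;> simp)
    obtain ⟨b, hb⟩ := H !₂[1, -1, -1] (by intro i; fin_cases i <;> simp)
    obtain ⟨c, hc⟩ := H !₂[-1, 1, -1] (by intro i; fin_cases i <;> simp)
    obtain ⟨d, hd⟩ := H !₂[-1, -1, 1] (by intro i; fin_cases i <;> simp)
    rw [hin] at ha hb hc hd
    simp at ha hb hc hd
    refine ⟨![a + b, a + c, a + d], ⟨a, ?_⟩, ?_⟩
    · have : ((a : ℝ) + b + c + d) = 0 := by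
        have h2 : 2 * Real.pi * ((a : ℝ) + b + c + d) = 0 := by
          linear_combination - ha - hb - hc - hd
        rcases mul_eq_zero.1 h2 with h3 | h3
        · exact absurd h3 (by positivity)
        · exact h3
      have h' : a + b + c + d = 0 := by exact_mod_cast this
      simp
      linarith
    · intro i
      fin_cases i <;> simp <;> linarith

/-- The Brillouin zone: wave-vectors modulo the reciprocal lattice. It is the rhombic dodecahedron
`rhombicDodecahedron` with its boundary points identified (see `exists_mem_rhombicDodecahedron`
and `injOn_interior_rhombicDodecahedron`). -/
def Brill : Type := E3 ⧸ reciprocalLattice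

instance : TopologicalSpace Brill :=
  inferInstanceAs (TopologicalSpace (E3 ⧸ reciprocalLattice))

/-- The class in the Brillouin zone of a wave-vector. -/
def toBrill (k : E3) : Brill := QuotientAddGroup.mk k

theorem toBrill_surjective : Function.Surjective toBrill := QuotientAddGroup.mk_surjective

theorem toBrill_eq_iff {k k' : E3} : toBrill k = toBrill k' ↔ k' - k ∈ reciprocalLattice := by
  rw [sub_eq_neg_add]
  exact QuotientAddGroup.eq

theorem pi_le_norm {G : E3} (hG : G ∈ reciprocalLattice) (hne : G ≠ 0) : Real.pi ≤ ‖G‖ := by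
  obtain ⟨m, _, hm⟩ := hG
  have hex : ∃ i, m i ≠ 0 := by
    by_contra! h0
    apply hne
    ext i
    simp [hm i, h0 i]
  obtain ⟨i, hi⟩ := hex
  refine le_trans ?_ (PiLp.norm_apply_le G i)
  rw [hm i, norm_mul, Real.norm_eq_abs, Real.norm_eq_abs, abs_of_pos Real.pi_pos]
  have : (1 : ℝ) ≤ |(m i : ℝ)| := by exact_mod_cast Int.one_le_abs hi
  nlinarith [Real.pi_pos]

theorem isDiscrete_reciprocalLattice : IsDiscrete (reciprocalLattice : Set E3) := by
  constructor
  apply DiscreteTopology.of_forall_le_norm (E := reciprocalLattice) (r := Real.pi) Real.pi_pos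
  intro G hne
  exact pi_le_norm G.2 (by simpa using hne)

theorem isLocalHomeomorph_toBrill : IsLocalHomeomorph toBrill :=
  (AddSubgroup.isAddQuotientCoveringMap_of_comm reciprocalLattice
    isDiscrete_reciprocalLattice).isCoveringMap.isLocalHomeomorph

/-- The charts of the Brillouin zone are the local inverses of the projection from `ℝ³`. -/
instance : ChartedSpace E3 Brill :=
  isLocalHomeomorph_toBrill.chartedSpace toBrill_surjective

/-- The Brillouin zone is an (analytic, in particular smooth) manifold. -/
instance (r : ℕ∞ω) : IsManifold 𝓘(ℝ, E3) r Brill := by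
  apply isManifold_of_contDiffOn
  rintro _ _ ⟨p, rfl⟩ ⟨q, rfl⟩
  generalize (toBrill_surjective.hasRightInverse.choose p) = x
  generalize (toBrill_surjective.hasRightInverse.choose q) = y
  simp only [chartAt_self_eq, OpenPartialHomeomorph.trans_refl]
  generalize hx : isLocalHomeomorph_toBrill.localInverseAt x = e
  generalize hy : isLocalHomeomorph_toBrill.localInverseAt y = f
  have he : ⇑e.symm = toBrill := by rw [← hx]; simp
  have hf : ∀ w ∈ f.source, toBrill (f w) = w := by
    intro w hw
    have := f.left_inv hw
    rwa [← hy, isLocalHomeomorph_toBrill.localInverseAt_symm, hy] at this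
  intro z hz
  have hz' : z ∈ (e.symm ≫ₕ f).source := hz.1
  apply ContDiffAt.contDiffWithinAt
  change ContDiffAt ℝ r (e.symm ≫ₕ f) z
  have hmem : ∀ w ∈ (e.symm ≫ₕ f).source, (e.symm ≫ₕ f) w - w ∈ reciprocalLattice := by
    intro w hw
    rw [OpenPartialHomeomorph.trans_source, he] at hw
    rw [← toBrill_eq_iff, OpenPartialHomeomorph.coe_trans, Function.comp_apply, he]
    exact (hf _ hw.2).symm
  have hcont : ContinuousAt (fun w => (e.symm ≫ₕ f) w - w) z :=
    ((e.symm ≫ₕ f).continuousAt hz').sub continuousAt_id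
  have hev : (e.symm ≫ₕ f) =ᶠ[𝓝 z] fun w => w + ((e.symm ≫ₕ f) z - z) := by
    filter_upwards [(e.symm ≫ₕ f).open_source.mem_nhds hz',
      hcont.eventually (Metric.ball_mem_nhds _ Real.pi_pos)] with w hw hd
    by_contra hne
    refine absurd (pi_le_norm (reciprocalLattice.sub_mem (hmem w hw) (hmem z hz')) ?_) ?_
    · intro h0
      apply hne
      rw [sub_eq_zero] at h0
      rw [← h0]
      abel
    · rw [dist_eq_norm] at hd
      exact not_le.2 hd
  exact (contDiffAt_id.add contDiffAt_const).congr_of_eventuallyEq hev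

/-- The rhombic dodecahedron cut out by `|kᵢ ± kⱼ| ≤ π` for `i ≠ j`. -/
def rhombicDodecahedron : Set E3 :=
  {k | ∀ i j, i ≠ j → |k i + k j| ≤ Real.pi ∧ |k i - k j| ≤ Real.pi}

/-- Every point of the Brillouin zone is represented in the rhombic dodecahedron. -/
theorem exists_mem_rhombicDodecahedron (p : Brill) :
    ∃ k ∈ rhombicDodecahedron, toBrill k = p := by
  obtain ⟨k, rfl⟩ := toBrill_surjective p
  have hpi := Real.pi_pos
  let m : Fin 3 → ℤ := fun i => round (k i / Real.pi)
  let r : Fin 3 → ℝ := fun i => k i - Real.pi * m i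
  have hr : ∀ i, |r i| ≤ Real.pi / 2 := by
    intro i
    have h1 := abs_sub_round (k i / Real.pi)
    have h2 : r i = Real.pi * (k i / Real.pi - m i) := by
      simp only [r]
      field_simp
    rw [h2, abs_mul, abs_of_pos hpi]
    nlinarith
  have hab : ∀ {a b : ℝ}, |a| + |b| ≤ Real.pi → |a + b| ≤ Real.pi ∧ |a - b| ≤ Real.pi :=
    fun h => ⟨(abs_add_le _ _).trans h, (abs_sub _ _).trans h⟩
  rcases Int.even_or_odd (m 0 + m 1 + m 2) with hev | hodd
  · refine ⟨WithLp.toLp 2 r, fun i j _ => hab ?_, toBrill_eq_iff.2 ⟨m, hev, fun i => ?_⟩⟩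
    · have := hr i
      have := hr j
      simp only
      linarith
    · simp [r]
  · obtain ⟨i₀, hi₀⟩ := Finite.exists_max fun i => |r i|
    obtain ⟨s, hs, hsr⟩ : ∃ s : ℤ, (s = 1 ∨ s = -1) ∧ |r i₀ - Real.pi * s| = Real.pi - |r i₀| := by
      have := hr i₀
      rcases le_total 0 (r i₀) with h | h
      · refine ⟨1, Or.inl rfl, ?_⟩
        rw [abs_of_nonneg h] at this ⊢
        rw [abs_of_nonpos (by push_cast; linarith)]
        push_cast
        ring
      · refine ⟨-1, Or.inr rfl, ?_⟩
        rw [abs_of_nonpos h] at this ⊢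
        rw [abs_of_nonneg (by push_cast; linarith)]
        push_cast
        ring
    let r' : Fin 3 → ℝ := Function.update r i₀ (r i₀ - Real.pi * s)
    let m' : Fin 3 → ℤ := Function.update m i₀ (m i₀ + s)
    have hm' : Even (m' 0 + m' 1 + m' 2) := by
      obtain ⟨c, hc⟩ := hodd
      have : m' 0 + m' 1 + m' 2 = m 0 + m 1 + m 2 + s := by
        fin_cases i₀ <;> simp [m'] <;> ring
      rw [this, hc]
      rcases hs with rfl | rfl
      · exact ⟨c + 1, by ring⟩
      · exact ⟨c, by ring⟩
    refine ⟨WithLp.toLp 2 r', fun i j hij => hab ?_, toBrill_eq_iff.2 ⟨m', hm', fun i => ?_⟩⟩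
    · have h1 := hr i
      have h2 := hr j
      have h3 := hi₀ i
      have h4 := hi₀ j
      by_cases hi : i = i₀
      · subst hi
        simp only [r', Function.update_self, Function.update_of_ne hij.symm, hsr]
        linarith
      · by_cases hj : j = i₀
        · subst hj
          simp only [r', Function.update_self, Function.update_of_ne hij, hsr]
          linarith
        · simp only [r', Function.update_of_ne hi, Function.update_of_ne hj]
          linarith
    · by_cases hi : i = i₀
      · subst hi
        simp [r', m', r]
        ring
      · simp [r', m', r, Function.update_of_ne hi]

/-- No two points in the open rhombic dodecahedron are identified. -/
theorem injOn_interior_rhombicDodecahedron :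
    InjOn toBrill {k | ∀ i j, i ≠ j → |k i + k j| < Real.pi ∧ |k i - k j| < Real.pi} := by
  intro k hk k' hk' h
  obtain ⟨m, ⟨c, hc⟩, hm⟩ := toBrill_eq_iff.1 h
  have hpi := Real.pi_pos
  have key : ∀ i j, i ≠ j → |m i + m j| < 2 ∧ |m i - m j| < 2 := by
    intro i j hij
    obtain ⟨h1, h2⟩ := hk i j hij
    obtain ⟨h3, h4⟩ := hk' i j hij
    have hi := hm i
    have hj := hm j
    simp only [PiLp.sub_apply] at hi hj
    rw [abs_lt] at h1 h2 h3 h4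
    have e1 : |((m i + m j : ℤ) : ℝ)| < 2 := by
      push_cast
      rw [abs_lt]
      constructor <;> nlinarith
    have e2 : |((m i - m j : ℤ) : ℝ)| < 2 := by
      push_cast
      rw [abs_lt]
      constructor <;> nlinarith
    exact ⟨by exact_mod_cast e1, by exact_mod_cast e2⟩
  have h01 := key 0 1 (by decide)
  have h02 := key 0 2 (by decide)
  have h12 := key 1 2 (by decide)
  simp only [abs_lt] at h01 h02 h12
  have b0 : m 0 = -1 ∨ m 0 = 0 ∨ m 0 = 1 := by omega
  have b1 : m 1 = -1 ∨ m 1 = 0 ∨ m 1 = 1 := by omega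
  have z0 : m 0 = 0 := by omega
  have z1 : m 1 = 0 := by omega
  have z2 : m 2 = 0 := by omega
  have hz : ∀ i, m i = 0 := by
    intro i
    fin_cases i
    exacts [z0, z1, z2]
  ext i
  have := hm i
  rw [hz i] at this
  simp at this
  linarith

/-! ### The Weyl walk -/

/-- `λ(k) = cos kx cos ky cos kz - sin kx sin ky sin kz` on `ℝ³`. -/
def lamFun (k : E3) : ℝ :=
  Real.cos (k 0) * Real.cos (k 1) * Real.cos (k 2) - Real.sin (k 0) * Real.sin (k 1) * Real.sin (k 2)

/-- The vector `n(k)` of the Weyl walk on `ℝ³`. -/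
def nFun (k : E3) : E3 :=
  !₂[Real.sin (k 0) * Real.cos (k 1) * Real.cos (k 2)
        + Real.cos (k 0) * Real.sin (k 1) * Real.sin (k 2),
     Real.cos (k 0) * Real.sin (k 1) * Real.cos (k 2)
        - Real.sin (k 0) * Real.cos (k 1) * Real.sin (k 2),
     Real.cos (k 0) * Real.cos (k 1) * Real.sin (k 2)
        + Real.sin (k 0) * Real.sin (k 1) * Real.cos (k 2)]

/-- `cos (2 ky)` on `ℝ³`. -/
def cosTwoKyFun (k : E3) : ℝ := Real.cos (2 * k 1)

theorem exists_shift {k k' : E3} (h : k' - k ∈ reciprocalLattice) :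
    ∃ ε : Fin 3 → ℝ, (∀ i, Real.cos (k' i) = ε i * Real.cos (k i)) ∧
      (∀ i, Real.sin (k' i) = ε i * Real.sin (k i)) ∧ (∀ i, ε i * ε i = 1) ∧
      ε 0 * ε 1 * ε 2 = 1 := by
  obtain ⟨m, hev, hm⟩ := h
  have hk : ∀ i, k' i = k i + m i * Real.pi := by
    intro i
    have := hm i
    simp only [PiLp.sub_apply] at this
    linarith
  refine ⟨fun i => (-1) ^ (m i), fun i => ?_, fun i => ?_, fun i => ?_, ?_⟩
  · rw [hk, Real.cos_add_int_mul_pi]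
  · rw [hk, Real.sin_add_int_mul_pi]
  · rw [← zpow_add₀ (by norm_num)]
    exact Even.neg_one_zpow ⟨m i, rfl⟩
  · rw [← zpow_add₀ (by norm_num), ← zpow_add₀ (by norm_num)]
    exact Even.neg_one_zpow hev

theorem lamFun_eq {k k' : E3} (h : k' - k ∈ reciprocalLattice) : lamFun k = lamFun k' := by
  obtain ⟨ε, hc, hs, -, h3⟩ := exists_shift h
  simp only [lamFun, hc, hs]
  linear_combination (Real.sin (k 0) * Real.sin (k 1) * Real.sin (k 2)
    - Real.cos (k 0) * Real.cos (k 1) * Real.cos (k 2)) * h3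

theorem nFun_eq {k k' : E3} (h : k' - k ∈ reciprocalLattice) : nFun k = nFun k' := by
  obtain ⟨ε, hc, hs, -, h3⟩ := exists_shift h
  ext i
  fin_cases i
  · simp [nFun, hc, hs]
    linear_combination -(Real.sin (k 0) * Real.cos (k 1) * Real.cos (k 2)
        + Real.cos (k 0) * Real.sin (k 1) * Real.sin (k 2)) * h3
  · simp [nFun, hc, hs]
    linear_combination -(Real.cos (k 0) * Real.sin (k 1) * Real.cos (k 2)
        - Real.sin (k 0) * Real.cos (k 1) * Real.sin (k 2)) * h3
  · simp [nFun, hc, hs]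
    linear_combination -(Real.cos (k 0) * Real.cos (k 1) * Real.sin (k 2)
        + Real.sin (k 0) * Real.sin (k 1) * Real.cos (k 2)) * h3

theorem cosTwoKyFun_eq {k k' : E3} (h : k' - k ∈ reciprocalLattice) :
    cosTwoKyFun k = cosTwoKyFun k' := by
  obtain ⟨ε, hc, -, h2, -⟩ := exists_shift h
  simp only [cosTwoKyFun, Real.cos_two_mul, hc]
  linear_combination -(2 * Real.cos (k 1) ^ 2) * h2 1

/-- The function `λ` on the Brillouin zone. -/
def lam : Brill → ℝ :=
  Quotient.lift lamFun fun _ _ h => lamFun_eq (toBrill_eq_iff.1 (Quotient.sound h))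

/-- The map `n` on the Brillouin zone. -/
def nMap : Brill → E3 :=
  Quotient.lift nFun fun _ _ h => nFun_eq (toBrill_eq_iff.1 (Quotient.sound h))

/-- The function `cos (2 ky)` on the Brillouin zone. -/
def cosTwoKy : Brill → ℝ :=
  Quotient.lift cosTwoKyFun fun _ _ h => cosTwoKyFun_eq (toBrill_eq_iff.1 (Quotient.sound h))

theorem lam_toBrill (k : E3) : lam (toBrill k) = lamFun k := rfl

theorem nMap_toBrill (k : E3) : nMap (toBrill k) = nFun k := rfl

theorem cosTwoKy_toBrill (k : E3) : cosTwoKy (toBrill k) = cosTwoKyFun k := rfl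

theorem continuous_lam : Continuous lam :=
  Continuous.quotient_lift (by unfold lamFun; fun_prop) _

theorem continuous_cosTwoKy : Continuous cosTwoKy :=
  Continuous.quotient_lift (by unfold cosTwoKyFun; fun_prop) _

/-- The singular set, where `λ = 0` or `cos (2 ky) = 0`. -/
def singularSet : Set Brill := {p | lam p = 0} ∪ {p | cosTwoKy p = 0}

/-- The four open regions given by the signs of `λ` and `cos (2 ky)`. -/
def region : Fin 4 → TopologicalSpace.Opens Brill :=
  ![⟨{p | 0 < lam p ∧ 0 < cosTwoKy p},
      (isOpen_lt continuous_const continuous_lam).inter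
        (isOpen_lt continuous_const continuous_cosTwoKy)⟩,
    ⟨{p | lam p < 0 ∧ 0 < cosTwoKy p},
      (isOpen_lt continuous_lam continuous_const).inter
        (isOpen_lt continuous_const continuous_cosTwoKy)⟩,
    ⟨{p | 0 < lam p ∧ cosTwoKy p < 0},
      (isOpen_lt continuous_const continuous_lam).inter
        (isOpen_lt continuous_cosTwoKy continuous_const)⟩,
    ⟨{p | lam p < 0 ∧ cosTwoKy p < 0},
      (isOpen_lt continuous_lam continuous_const).inter
        (isOpen_lt continuous_cosTwoKy continuous_const)⟩]

/-! ### The pierced balls -/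

/-- The ellipse `t ↦ (sin t, cos t, sin t) / √2`. -/
def ePlus (t : ℝ) : E3 := (1 / √2 : ℝ) • !₂[Real.sin t, Real.cos t, Real.sin t]

/-- The ellipse `t ↦ (sin t, cos t, -sin t) / √2`. -/
def eMinus (t : ℝ) : E3 := (1 / √2 : ℝ) • !₂[Real.sin t, Real.cos t, -Real.sin t]

/-- The parameter interval `(-π/2, π/2)`. -/
def T₁ : Set ℝ := Ioo (-(Real.pi / 2)) (Real.pi / 2)

/-- The parameter set `(-π, -π/2) ∪ (π/2, π]`. -/
def T₂ : Set ℝ := Ioo (-Real.pi) (-(Real.pi / 2)) ∪ Ioc (Real.pi / 2) Real.pi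

/-- The open unit ball without the arches `e₊(T₁)` and `e₋(T₂)`. -/
def Qa : Set E3 := Metric.ball 0 1 \ (ePlus '' T₁ ∪ eMinus '' T₂)

/-- The open unit ball without the arches `e₊(T₂)` and `e₋(T₁)`. -/
def Qb : Set E3 := Metric.ball 0 1 \ (ePlus '' T₂ ∪ eMinus '' T₁)

end WeylWalk

end

namespace WeylWalk

/-! ### Polar form of `(λ, n)` -/

/-! Put `A = cos ky + sin ky`, `B = cos ky - sin ky` and pair the coordinates of `(λ, n)` into `U =
(λ + n₁) + i (n₀ + n₂)` and `V = (λ - n₁) + i (n₀ - n₂)`. Then `U = A exp(i(kx + kz))` and `V = B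
exp(i(kx - kz))`, with `A² + B² = 2` and `AB = cos(2ky)`. So `(λ, n)` lies on the unit 3-sphere, `k`
gives polar coordinates on it, and `UV = 0` exactly where `cos(2ky) = 0`.

Off that set, `U`, `V` and the sign of `AB` fix `(A, B)` up to a common sign and the angles up to a
matching multiple of `π`; this ambiguity is the reciprocal lattice (`toBrill_eq_of_lamFun_eq`). On a
region `n` also fixes `λ`, hence injectivity. Differentiating the polar identities makes `dn`
invertible (`fderiv_nFun_injective`), hence a diffeomorphism. For `λ > 0`, the circles `U = 0` and
`V = 0` project to the arches `e₋(T₂)` and `e₊(T₁)`, and every other point of the hemisphere is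
attained (`exists_lamFun_eq_nFun_eq`), so the image of region 0 is `Qa`. That region is connected
because wave-vectors can be shrunk inside a box without decreasing `λ`. Two involutions carry region
0 to the other three. -/

theorem lamFun_add_nFun_one (k : E3) :
    lamFun k + nFun k 1 = (Real.cos (k 1) + Real.sin (k 1)) * Real.cos (k 0 + k 2) := by
  simp [lamFun, nFun, Real.cos_add]
  ring

theorem lamFun_sub_nFun_one (k : E3) :
    lamFun k - nFun k 1 = (Real.cos (k 1) - Real.sin (k 1)) * Real.cos (k 0 - k 2) := by
  simp [lamFun, nFun, Real.cos_sub]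
  ring

theorem nFun_zero_add_two (k : E3) :
    nFun k 0 + nFun k 2 = (Real.cos (k 1) + Real.sin (k 1)) * Real.sin (k 0 + k 2) := by
  simp [nFun, Real.sin_add]
  ring

theorem nFun_zero_sub_two (k : E3) :
    nFun k 0 - nFun k 2 = (Real.cos (k 1) - Real.sin (k 1)) * Real.sin (k 0 - k 2) := by
  simp [nFun, Real.sin_sub]
  ring

theorem cosTwoKyFun_eq_mul (k : E3) : cosTwoKyFun k =
    (Real.cos (k 1) + Real.sin (k 1)) * (Real.cos (k 1) - Real.sin (k 1)) := by
  rw [cosTwoKyFun, Real.cos_two_mul']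
  ring

/-- The parallelogram identity turns `|U|² + |V|² = A² + B² = 2` into this sphere equation. -/
theorem lamFun_sq_add (k : E3) :
    lamFun k ^ 2 + (nFun k 0 ^ 2 + nFun k 1 ^ 2 + nFun k 2 ^ 2) = 1 := by
  have h1 := lamFun_add_nFun_one k
  have h2 := lamFun_sub_nFun_one k
  have h3 := nFun_zero_add_two k
  have h4 := nFun_zero_sub_two k
  have e1 := Real.sin_sq_add_cos_sq (k 0 + k 2)
  have e2 := Real.sin_sq_add_cos_sq (k 0 - k 2)
  have e3 := Real.sin_sq_add_cos_sq (k 1)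
  have a1 : (lamFun k + nFun k 1) ^ 2 + (nFun k 0 + nFun k 2) ^ 2
      = (Real.cos (k 1) + Real.sin (k 1)) ^ 2 := by
    rw [h1, h3]
    linear_combination (Real.cos (k 1) + Real.sin (k 1)) ^ 2 * e1
  have a2 : (lamFun k - nFun k 1) ^ 2 + (nFun k 0 - nFun k 2) ^ 2
      = (Real.cos (k 1) - Real.sin (k 1)) ^ 2 := by
    rw [h2, h4]
    linear_combination (Real.cos (k 1) - Real.sin (k 1)) ^ 2 * e2
  linear_combination (a1 + a2) / 2 + e3

/-! ### Injectivity -/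

/-- Two angles whose cosine and sine agree up to a common sign differ by a multiple of `π`. -/
theorem exists_int_mul_pi {a b : ℝ} {s : ℤ}
    (hc : Real.cos b = (-1) ^ s * Real.cos a) (hn : Real.sin b = (-1) ^ s * Real.sin a) :
    ∃ m : ℤ, b = a + (2 * m + s) * Real.pi := by
  have hh : (b : Real.Angle) = ((a + s * Real.pi : ℝ) : Real.Angle) := by
    apply Real.Angle.cos_sin_inj
    · rw [hc, Real.cos_add_int_mul_pi]
    · rw [hn, Real.sin_add_int_mul_pi]
  obtain ⟨m, hm⟩ := Real.Angle.angle_eq_iff_two_pi_dvd_sub.1 hh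
  exact ⟨m, by linear_combination hm⟩

/-- A wave-vector off the singular set is determined, up to the reciprocal lattice, by `λ`, `n`
and the sign of `cos (2 ky)`. -/
theorem toBrill_eq_of_lamFun_eq {k k' : E3} (hl : lamFun k = lamFun k') (hn : nFun k = nFun k')
    (hc : 0 < cosTwoKyFun k * cosTwoKyFun k') : toBrill k = toBrill k' := by
  have h1 := lamFun_add_nFun_one k
  have h2 := lamFun_sub_nFun_one k
  have h3 := nFun_zero_add_two k
  have h4 := nFun_zero_sub_two k
  rw [hn, hl] at h1 h2
  rw [hn] at h3 h4
  rw [lamFun_add_nFun_one] at h1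
  rw [lamFun_sub_nFun_one] at h2
  rw [nFun_zero_add_two] at h3
  rw [nFun_zero_sub_two] at h4
  rw [cosTwoKyFun_eq_mul, cosTwoKyFun_eq_mul] at hc
  have e1 := Real.sin_sq_add_cos_sq (k 0 + k 2)
  have e2 := Real.sin_sq_add_cos_sq (k 0 - k 2)
  have e1' := Real.sin_sq_add_cos_sq (k' 0 + k' 2)
  have e2' := Real.sin_sq_add_cos_sq (k' 0 - k' 2)
  generalize hA : Real.cos (k 1) + Real.sin (k 1) = A at *
  generalize hB : Real.cos (k 1) - Real.sin (k 1) = B at *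
  generalize hA' : Real.cos (k' 1) + Real.sin (k' 1) = A' at *
  generalize hB' : Real.cos (k' 1) - Real.sin (k' 1) = B' at *
  have hA0 : A ≠ 0 := by rintro rfl; simp at hc
  have hB0 : B ≠ 0 := by rintro rfl; simp at hc
  have sA : A' ^ 2 = A ^ 2 := by
    have : (A' * Real.cos (k' 0 + k' 2)) ^ 2 + (A' * Real.sin (k' 0 + k' 2)) ^ 2
      = (A * Real.cos (k 0 + k 2)) ^ 2 + (A * Real.sin (k 0 + k 2)) ^ 2 := by rw [h1, h3]
    linear_combination this - A' ^ 2 * e1' + A ^ 2 * e1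
  have sB : B' ^ 2 = B ^ 2 := by
    have : (B' * Real.cos (k' 0 - k' 2)) ^ 2 + (B' * Real.sin (k' 0 - k' 2)) ^ 2
      = (B * Real.cos (k 0 - k 2)) ^ 2 + (B * Real.sin (k 0 - k 2)) ^ 2 := by rw [h2, h4]
    linear_combination this - B' ^ 2 * e2' + B ^ 2 * e2
  -- Equal moduli leave four sign choices; since `AB` and `A'B'` have the same sign, the mixed ones
  -- are excluded.
  obtain ⟨s, hs, hAs, hBs⟩ : ∃ s : ℤ, (s = 0 ∨ s = 1) ∧ A' = (-1) ^ s * A ∧ B' = (-1) ^ s * B := by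
    rcases sq_eq_sq_iff_eq_or_eq_neg.1 sA with rfl | rfl <;>
      rcases sq_eq_sq_iff_eq_or_eq_neg.1 sB with rfl | rfl
    · exact ⟨0, by simp⟩
    · nlinarith [sq_nonneg (A' * B)]
    · nlinarith [sq_nonneg (A * B')]
    · exact ⟨1, by simp⟩
  have hss : ((-1 : ℝ) ^ s) * (-1) ^ s = 1 := by
    rcases hs with rfl | rfl <;> norm_num
  rw [hAs] at h1 h3
  rw [hBs] at h2 h4
  generalize hε : ((-1 : ℝ) ^ s) = ε at hss
  rw [hε] at h1 h2 h3 h4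
  obtain ⟨a, ha⟩ := exists_int_mul_pi (a := k 0 + k 2) (b := k' 0 + k' 2)
    (mul_left_cancel₀ hA0 (by
      rw [hε]; linear_combination ε * h1 - A * Real.cos (k' 0 + k' 2) * hss))
    (mul_left_cancel₀ hA0 (by
      rw [hε]; linear_combination ε * h3 - A * Real.sin (k' 0 + k' 2) * hss))
  obtain ⟨b, hb⟩ := exists_int_mul_pi (a := k 0 - k 2) (b := k' 0 - k' 2)
    (mul_left_cancel₀ hB0 (by
      rw [hε]; linear_combination ε * h2 - B * Real.cos (k' 0 - k' 2) * hss))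
    (mul_left_cancel₀ hB0 (by
      rw [hε]; linear_combination ε * h4 - B * Real.sin (k' 0 - k' 2) * hss))
  obtain ⟨c, hcc⟩ := exists_int_mul_pi (a := k 1) (b := k' 1)
    (by linear_combination (hA' + hB' + hAs + hBs) / 2 - (-1) ^ s * (hA + hB) / 2)
    (by linear_combination (hA' - hB' + hAs - hBs) / 2 - (-1) ^ s * (hA - hB) / 2)
  -- Half-sum and half-difference of the two angle shifts. The same `s` occurs in all three shifts,
  -- which makes the coordinate sum even.
  refine toBrill_eq_iff.2 ⟨![a + b + s, 2 * c + s, a - b], ⟨a + s + c, ?_⟩, fun i => ?_⟩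
  · simp
    ring
  · fin_cases i <;> simp
    · linear_combination (ha + hb) / 2
    · linear_combination hcc
    · linear_combination (ha - hb) / 2

/-! ### The derivative of `n` -/

theorem contDiff_nFun : ContDiff ℝ ∞ nFun := by
  unfold nFun
  rw [contDiff_euclidean]
  intro i
  fin_cases i <;> simp <;> fun_prop

theorem hasDerivAt_line (k w : E3) (i : Fin 3) :
    HasDerivAt (fun t : ℝ => (k + t • w) i) (w i) 0 := by
  have := ((hasDerivAt_id (0 : ℝ)).mul_const (w i)).const_add (k i)
  simpa using this

/-- Restricting to lines lets the polar identities be differentiated in one real variable. -/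
theorem hasDerivAt_nFun_line (k w : E3) (i : Fin 3) :
    HasDerivAt (fun t : ℝ => nFun (k + t • w) i) (fderiv ℝ nFun k w i) 0 := by
  have h1 : HasFDerivAt nFun (fderiv ℝ nFun k) k :=
    (contDiff_nFun.differentiable (by simp) k).hasFDerivAt
  have h2 := h1.hasLineDerivAt w
  exact ((EuclideanSpace.proj (𝕜 := ℝ) i).hasFDerivAt.comp_hasDerivAt (0 : ℝ) h2)

/-- Where `λ` and `cos (2 ky)` do not vanish, the derivative of `n` is injective. -/
theorem fderiv_nFun_injective {k : E3} (hl : lamFun k ≠ 0) (hc : cosTwoKyFun k ≠ 0) :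
    Function.Injective (fderiv ℝ nFun k) := by
  rw [injective_iff_map_eq_zero]
  intro w hw
  have hn : ∀ i, HasDerivAt (fun t : ℝ => nFun (k + t • w) i) 0 0 := fun i => by
    simpa [hw] using hasDerivAt_nFun_line k w i
  have hk := hasDerivAt_line k w
  have hlam : HasDerivAt (fun t : ℝ => lamFun (k + t • w)) 0 0 := by
    have hd : DifferentiableAt ℝ (fun t : ℝ => lamFun (k + t • w)) 0 := by
      unfold lamFun
      have := fun i => (hk i).differentiableAt
      fun_prop
    have h1 := hd.hasDerivAt
    -- Differentiating the sphere equation with `n' = 0` leaves `2λλ' = 0`, so `λ' = 0` as well.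
    have h2 := (h1.pow 2).add ((((hn 0).pow 2).add ((hn 1).pow 2)).add ((hn 2).pow 2))
    have h3 := h2.unique ((hasDerivAt_const (0 : ℝ) (1 : ℝ)).congr_of_eventuallyEq
      (Filter.Eventually.of_forall fun t => lamFun_sq_add (k + t • w)))
    have h4 : deriv (fun t : ℝ => lamFun (k + t • w)) 0 = 0 := by simpa [hl] using h3
    rwa [h4] at h1
  have hp := (hk 0).add (hk 2)
  have hq := (hk 0).sub (hk 2)
  have hA := (hk 1).cos.add (hk 1).sin
  have hB := (hk 1).cos.sub (hk 1).sin
  have u1 := (hA.mul hp.cos).unique ((hlam.add (hn 1)).congr_of_eventuallyEq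
    (Filter.Eventually.of_forall fun t => (lamFun_add_nFun_one (k + t • w)).symm))
  have u2 := (hA.mul hp.sin).unique (((hn 0).add (hn 2)).congr_of_eventuallyEq
    (Filter.Eventually.of_forall fun t => (nFun_zero_add_two (k + t • w)).symm))
  have v1 := (hB.mul hq.cos).unique ((hlam.sub (hn 1)).congr_of_eventuallyEq
    (Filter.Eventually.of_forall fun t => (lamFun_sub_nFun_one (k + t • w)).symm))
  have v2 := (hB.mul hq.sin).unique (((hn 0).sub (hn 2)).congr_of_eventuallyEq
    (Filter.Eventually.of_forall fun t => (nFun_zero_sub_two (k + t • w)).symm))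
  rw [cosTwoKyFun_eq_mul] at hc
  have hA0 := left_ne_zero_of_mul hc
  have hB0 := right_ne_zero_of_mul hc
  simp at u1 u2 v1 v2
  have e1 := Real.sin_sq_add_cos_sq (k 0 + k 2)
  have e2 := Real.sin_sq_add_cos_sq (k 0 - k 2)
  generalize Real.sin (k 0 + k 2) = sp at *
  generalize Real.cos (k 0 + k 2) = cp at *
  generalize Real.sin (k 0 - k 2) = sq at *
  generalize Real.cos (k 0 - k 2) = cq at *
  generalize Real.sin (k 1) = s at *
  generalize Real.cos (k 1) = c at *
  -- With `U' = V' = 0`, the radial part of `U'` is `A' = B w₁`; the tangential parts of `U'` and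
  -- `V'` are `A (w₀ + w₂)` and `B (w₀ - w₂)`.
  have r1 : w 1 = 0 := mul_left_cancel₀ hB0 (by
    linear_combination cp * u1 + sp * u2 - (c - s) * w 1 * e1)
  have r2 : w 0 + w 2 = 0 := mul_left_cancel₀ hA0 (by
    linear_combination cp * u2 - sp * u1 - (c + s) * (w 0 + w 2) * e1)
  have r3 : w 0 - w 2 = 0 := mul_left_cancel₀ hB0 (by
    linear_combination cq * v2 - sq * v1 - (c - s) * (w 0 - w 2) * e2)
  ext i
  fin_cases i <;> simp <;> linarith

/-- The derivative of `n` as a linear equivalence. -/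
theorem exists_hasFDerivAt_nFun_equiv {k : E3} (hl : lamFun k ≠ 0) (hc : cosTwoKyFun k ≠ 0) :
    ∃ D : E3 ≃L[ℝ] E3, HasFDerivAt nFun (D : E3 →L[ℝ] E3) k := by
  refine ⟨(LinearEquiv.ofInjectiveEndo (fderiv ℝ nFun k : E3 →ₗ[ℝ] E3)
    (fderiv_nFun_injective hl hc)).toContinuousLinearEquiv, ?_⟩
  convert! (contDiff_nFun.differentiable (by simp) k).hasFDerivAt

/-! ### Smoothness on the Brillouin zone -/

theorem toBrill_chartAt (p : Brill) {q : Brill} (hq : q ∈ (chartAt E3 p).source) :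
    toBrill (chartAt E3 p q) = q :=
  isLocalHomeomorph_toBrill.apply_localInverseAt_of_mem (by
    simpa [chartAt, ChartedSpace.chartAt] using hq)

/-- A chart is a local section of the projection, so `nMap` is locally `nFun` after a chart. -/
theorem contMDiff_nMap : ContMDiff 𝓘(ℝ, E3) 𝓘(ℝ, E3) ∞ nMap := by
  intro p
  have h := (contDiff_nFun.contMDiff.contMDiffAt (x := chartAt E3 p p)).comp p
    (contMDiffOn_chart.contMDiffAt (chart_source_mem_nhds E3 p))
  refine h.congr_of_eventuallyEq ?_
  filter_upwards [chart_source_mem_nhds E3 p] with q hq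
  rw [Function.comp_apply, ← nMap_toBrill, toBrill_chartAt p hq]

/-- The chart may lift the class of `x` to another representative `x₀`; near `x` the projection is
translation by the lattice vector `x₀ - x` followed by the inverse chart. -/
theorem contMDiff_toBrill : ContMDiff 𝓘(ℝ, E3) 𝓘(ℝ, E3) ∞ toBrill := by
  intro x
  set e := chartAt E3 (toBrill x) with he
  set x₀ := e (toBrill x) with hx₀
  have hsrc : toBrill x ∈ e.source := mem_chart_source E3 _
  have hG : x₀ - x ∈ reciprocalLattice := by
    rw [← toBrill_eq_iff, hx₀, he, toBrill_chartAt _ hsrc]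
  have htgt : e.target ∈ 𝓝 (x + (x₀ - x)) := by
    rw [add_sub_cancel]
    exact e.open_target.mem_nhds (e.map_source hsrc)
  have hadd : ContMDiff 𝓘(ℝ, E3) 𝓘(ℝ, E3) ∞ fun y : E3 => y + (x₀ - x) :=
    (contDiff_id.add contDiff_const).contMDiff
  have h := ((contMDiffOn_chart_symm (x := toBrill x) (I := 𝓘(ℝ, E3)) (n := ∞)).contMDiffAt
    htgt).comp x hadd.contMDiffAt
  refine h.congr_of_eventuallyEq ?_
  filter_upwards [hadd.continuous.continuousAt.preimage_mem_nhds htgt] with y hy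
  have h1 := toBrill_chartAt (toBrill x) (e.map_target hy)
  rw [← he, e.right_inv hy] at h1
  rw [Function.comp_apply, ← he, ← h1, toBrill_eq_iff]
  simpa using hG

/-- Where `λ` and `cos (2 ky)` do not vanish, the map `n` has a smooth local section through
the Brillouin zone. -/
theorem exists_local_section {k : E3} (hl : lamFun k ≠ 0) (hc : cosTwoKyFun k ≠ 0) :
    ∃ g : E3 → Brill, ContMDiffAt 𝓘(ℝ, E3) 𝓘(ℝ, E3) ∞ g (nFun k) ∧ g (nFun k) = toBrill k ∧
      ∀ᶠ w in 𝓝 (nFun k), nMap (g w) = w := by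
  obtain ⟨D, hD⟩ := exists_hasFDerivAt_nFun_equiv hl hc
  have hf : ContDiffAt ℝ ∞ nFun k := contDiff_nFun.contDiffAt
  have hn : (∞ : ℕ∞ω) ≠ 0 := by simp
  refine ⟨toBrill ∘ hf.localInverse hD hn, ?_, ?_, ?_⟩
  · exact contMDiff_toBrill.contMDiffAt.comp _ (hf.to_localInverse hD hn).contMDiffAt
  · rw [Function.comp_apply, hf.localInverse_apply_image hD hn]
  · exact (hf.hasStrictFDerivAt' hD hn).eventually_right_inverse

/-! ### Existence of wave-vectors with given `(λ, n)` -/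

/-- Each point `(l, w)` of the unit sphere off the circles over `cos (2 ky) = 0` is a value of
`(λ, n)`, taken in the box `|ky| < π/4`, `|kx ± kz| ≤ π`. -/
theorem exists_lamFun_eq_nFun_eq {l : ℝ} {w : E3}
    (h : l ^ 2 + (w 0 ^ 2 + w 1 ^ 2 + w 2 ^ 2) = 1)
    (hu : ¬(l + w 1 = 0 ∧ w 0 + w 2 = 0)) (hv : ¬(l - w 1 = 0 ∧ w 0 - w 2 = 0)) :
    ∃ k : E3, lamFun k = l ∧ nFun k = w ∧ |k 1| < Real.pi / 4 ∧ |k 0 + k 2| ≤ Real.pi ∧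
      |k 0 - k 2| ≤ Real.pi := by
  set U : ℂ := ⟨l + w 1, w 0 + w 2⟩ with hU
  set V : ℂ := ⟨l - w 1, w 0 - w 2⟩ with hV
  have hU0 : 0 < ‖U‖ := norm_pos_iff.2 fun h0 => hu (by simpa [hU, Complex.ext_iff] using h0)
  have hV0 : 0 < ‖V‖ := norm_pos_iff.2 fun h0 => hv (by simpa [hV, Complex.ext_iff] using h0)
  have sU : ‖U‖ ^ 2 = (l + w 1) ^ 2 + (w 0 + w 2) ^ 2 := by
    rw [Complex.sq_norm, Complex.normSq_apply]
    ring
  have sV : ‖V‖ ^ 2 = (l - w 1) ^ 2 + (w 0 - w 2) ^ 2 := by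
    rw [Complex.sq_norm, Complex.normSq_apply]
    ring
  -- `Y` is to be `exp(i ky)`: the solution of `A = ‖U‖`, `B = ‖V‖`.
  set Y : ℂ := ⟨(‖U‖ + ‖V‖) / 2, (‖U‖ - ‖V‖) / 2⟩ with hY
  have hY1 : ‖Y‖ = 1 := by
    have : ‖Y‖ ^ 2 = 1 := by
      rw [Complex.sq_norm, Complex.normSq_apply]
      simp only [hY]
      linear_combination (sU + sV) / 2 + h
    nlinarith [norm_nonneg Y]
  have cU := Complex.norm_mul_cos_arg U
  have nU := Complex.norm_mul_sin_arg U
  have cV := Complex.norm_mul_cos_arg V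
  have nV := Complex.norm_mul_sin_arg V
  have cY := Complex.norm_mul_cos_arg Y
  have nY := Complex.norm_mul_sin_arg Y
  rw [hY1, one_mul] at cY nY
  simp only [hY] at cY nY
  rw [← hY] at cY nY
  set k : E3 := !₂[(U.arg + V.arg) / 2, Y.arg, (U.arg - V.arg) / 2] with hk
  have k1 : k 1 = Y.arg := by simp [hk]
  have kp : k 0 + k 2 = U.arg := by simp [hk]; ring
  have kq : k 0 - k 2 = V.arg := by simp [hk]; ring
  have h1 := lamFun_add_nFun_one k
  have h2 := lamFun_sub_nFun_one k
  have h3 := nFun_zero_add_two k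
  have h4 := nFun_zero_sub_two k
  rw [k1, kp, cY, nY, show (‖U‖ + ‖V‖) / 2 + (‖U‖ - ‖V‖) / 2 = ‖U‖ by ring] at h1 h3
  rw [k1, kq, cY, nY, show (‖U‖ + ‖V‖) / 2 - (‖U‖ - ‖V‖) / 2 = ‖V‖ by ring] at h2 h4
  rw [cU] at h1
  rw [cV] at h2
  rw [nU] at h3
  rw [nV] at h4
  simp only [hU] at h1 h3
  simp only [hV] at h2 h4
  refine ⟨k, by linarith, ?_, ?_, ?_, ?_⟩
  · ext i
    fin_cases i <;> simp only [Fin.zero_eta, Fin.mk_one, Fin.reduceFinMk] <;> linarith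
  · rw [k1]
    have hlt : |Y.arg| < Real.pi / 2 :=
      Complex.abs_arg_lt_pi_div_two_iff.2 (Or.inl (by simp only [hY]; positivity))
    -- `cos(2ky) = ‖U‖‖V‖ > 0` rules out `π/4 ≤ |ky| < π/2`.
    by_contra! hge
    have := Real.cos_nonpos_of_pi_div_two_le_of_le (x := 2 * |Y.arg|) (by linarith)
      (by linarith [Real.pi_pos])
    rw [← Real.cos_abs, abs_mul, abs_abs, ← abs_mul, Real.cos_abs, Real.cos_two_mul', cY, nY] at this
    nlinarith [mul_pos hU0 hV0]
  · rw [kp]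
    exact Complex.abs_arg_le_pi _
  · rw [kq]
    exact Complex.abs_arg_le_pi _

/-! ### The arches -/

theorem arch_sq_add (t : ℝ) : (1 / √2 * Real.sin t) ^ 2 + (1 / √2 * Real.cos t) ^ 2 = 1 / 2 := by
  rw [mul_pow, mul_pow, ← mul_add, Real.sin_sq_add_cos_sq, div_pow, Real.sq_sqrt (by norm_num)]
  norm_num

/-- Each point of the circle of radius `1/√2` has a parameter in `(-π, π]`. -/
theorem exists_arch_parameter {a b : ℝ} (h : a ^ 2 + b ^ 2 = 1 / 2) :
    ∃ t ∈ Ioc (-Real.pi) Real.pi, 1 / √2 * Real.sin t = a ∧ 1 / √2 * Real.cos t = b := by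
  have hz : ‖(⟨b, a⟩ : ℂ)‖ = 1 / √2 := by
    rw [Complex.norm_def, Complex.normSq_mk, ← Real.sqrt_one, ← Real.sqrt_div (by norm_num)]
    congr 1
    linarith
  refine ⟨Complex.arg ⟨b, a⟩, Complex.arg_mem_Ioc _, ?_, ?_⟩
  · rw [← hz, Complex.norm_mul_sin_arg]
  · rw [← hz, Complex.norm_mul_cos_arg]

theorem exists_mem_T₁_iff {a b : ℝ} :
    (∃ t ∈ T₁, 1 / √2 * Real.sin t = a ∧ 1 / √2 * Real.cos t = b) ↔
      0 < b ∧ a ^ 2 + b ^ 2 = 1 / 2 := by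
  have h2 : 0 < 1 / √2 := by positivity
  constructor
  · rintro ⟨t, ht, rfl, rfl⟩
    exact ⟨mul_pos h2 (Real.cos_pos_of_mem_Ioo ht), arch_sq_add t⟩
  · rintro ⟨hb, h⟩
    obtain ⟨t, ⟨ht1, ht2⟩, rfl, rfl⟩ := exists_arch_parameter h
    refine ⟨t, ?_, rfl, rfl⟩
    have hc := pos_of_mul_pos_right hb h2.le
    by_contra hT
    have habs : Real.pi / 2 ≤ |t| := by
      by_contra! hlt
      exact hT (abs_lt.1 hlt)
    have := Real.cos_nonpos_of_pi_div_two_le_of_le habs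
      (by linarith [abs_le.2 ⟨ht1.le, ht2⟩, Real.pi_pos])
    rw [Real.cos_abs] at this
    linarith

/-- `T₂` is the part of `(-π, π]` where the cosine is negative; the endpoint `π` supplies the lowest
point of the arch. -/
theorem exists_mem_T₂_iff {a b : ℝ} :
    (∃ t ∈ T₂, 1 / √2 * Real.sin t = a ∧ 1 / √2 * Real.cos t = b) ↔
      b < 0 ∧ a ^ 2 + b ^ 2 = 1 / 2 := by
  have h2 : 0 < 1 / √2 := by positivity
  constructor
  · rintro ⟨t, ht, rfl, rfl⟩
    refine ⟨mul_neg_of_pos_of_neg h2 ?_, arch_sq_add t⟩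
    rcases ht with ht | ht
    · rw [← Real.cos_neg]
      exact Real.cos_neg_of_pi_div_two_lt_of_lt (by linarith [ht.2])
        (by linarith [ht.1, Real.pi_pos])
    · exact Real.cos_neg_of_pi_div_two_lt_of_lt ht.1 (by linarith [ht.2, Real.pi_pos])
  · rintro ⟨hb, h⟩
    obtain ⟨t, ⟨ht1, ht2⟩, rfl, rfl⟩ := exists_arch_parameter h
    refine ⟨t, ?_, rfl, rfl⟩
    have hc := neg_of_mul_neg_right hb h2.le
    rcases lt_or_ge t (-(Real.pi / 2)) with hlt | hge
    · exact Or.inl ⟨ht1, hlt⟩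
    · refine Or.inr ⟨?_, ht2⟩
      by_contra! hle
      exact absurd (Real.cos_nonneg_of_mem_Icc ⟨hge, hle⟩) (not_le.2 hc)

theorem mem_ePlus_image {T : Set ℝ} {w : E3} : w ∈ ePlus '' T ↔
    w 0 = w 2 ∧ ∃ t ∈ T, 1 / √2 * Real.sin t = w 0 ∧ 1 / √2 * Real.cos t = w 1 := by
  constructor
  · rintro ⟨t, ht, rfl⟩
    exact ⟨by simp [ePlus], t, ht, by simp [ePlus]⟩
  · rintro ⟨h, t, ht, h0, h1⟩
    refine ⟨t, ht, ?_⟩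
    ext i
    fin_cases i
    · simpa [ePlus] using h0
    · simpa [ePlus] using h1
    · simpa [ePlus] using h0.trans h

theorem mem_eMinus_image {T : Set ℝ} {w : E3} : w ∈ eMinus '' T ↔
    w 0 = -w 2 ∧ ∃ t ∈ T, 1 / √2 * Real.sin t = w 0 ∧ 1 / √2 * Real.cos t = w 1 := by
  constructor
  · rintro ⟨t, ht, rfl⟩
    exact ⟨by simp [eMinus], t, ht, by simp [eMinus]⟩
  · rintro ⟨h, t, ht, h0, h1⟩
    refine ⟨t, ht, ?_⟩
    ext i
    fin_cases i
    · simpa [eMinus] using h0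
    · simpa [eMinus] using h1
    · have : -(1 / √2 * Real.sin t) = w 2 := by rw [h0, h, neg_neg]
      simpa [eMinus] using this

theorem mem_ball_iff {w : E3} : w ∈ Metric.ball (0 : E3) 1 ↔
    w 0 ^ 2 + w 1 ^ 2 + w 2 ^ 2 < 1 := by
  rw [mem_ball_zero_iff, ← sq_lt_one_iff₀ (norm_nonneg w), EuclideanSpace.real_norm_sq_eq,
    Fin.sum_univ_three]

/-- Eliminates the arch parameter, leaving polynomial conditions to compare with `U = 0` and `V =
0`. -/
theorem mem_Qa_iff {w : E3} : w ∈ Qa ↔ w 0 ^ 2 + w 1 ^ 2 + w 2 ^ 2 < 1 ∧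
    ¬((w 0 = w 2 ∧ 0 < w 1 ∧ w 0 ^ 2 + w 1 ^ 2 = 1 / 2) ∨
      (w 0 = -w 2 ∧ w 1 < 0 ∧ w 0 ^ 2 + w 1 ^ 2 = 1 / 2)) := by
  rw [Qa, mem_sdiff, mem_ball_iff, mem_union, mem_ePlus_image, mem_eMinus_image,
    exists_mem_T₁_iff, exists_mem_T₂_iff]

theorem mem_Qb_iff {w : E3} : w ∈ Qb ↔ w 0 ^ 2 + w 1 ^ 2 + w 2 ^ 2 < 1 ∧
    ¬((w 0 = w 2 ∧ w 1 < 0 ∧ w 0 ^ 2 + w 1 ^ 2 = 1 / 2) ∨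
      (w 0 = -w 2 ∧ 0 < w 1 ∧ w 0 ^ 2 + w 1 ^ 2 = 1 / 2)) := by
  rw [Qb, mem_sdiff, mem_ball_iff, mem_union, mem_ePlus_image, mem_eMinus_image,
    exists_mem_T₁_iff, exists_mem_T₂_iff]

theorem neg_mem_Qa_iff {w : E3} : -w ∈ Qa ↔ w ∈ Qb := by
  rw [mem_Qa_iff, mem_Qb_iff]
  simp [neg_eq_iff_eq_neg]

/-! ### The regions -/

theorem mem_region_zero {p : Brill} : p ∈ region 0 ↔ 0 < lam p ∧ 0 < cosTwoKy p := Iff.rfl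

theorem mem_region_one {p : Brill} : p ∈ region 1 ↔ lam p < 0 ∧ 0 < cosTwoKy p := Iff.rfl

theorem mem_region_two {p : Brill} : p ∈ region 2 ↔ 0 < lam p ∧ cosTwoKy p < 0 := Iff.rfl

theorem mem_region_three {p : Brill} : p ∈ region 3 ↔ lam p < 0 ∧ cosTwoKy p < 0 := Iff.rfl

theorem mul_pos_of_mem_region {i : Fin 4} {p q : Brill} (hp : p ∈ region i) (hq : q ∈ region i) :
    0 < lam p * lam q ∧ 0 < cosTwoKy p * cosTwoKy q := by
  fin_cases i
  · exact ⟨mul_pos hp.1 hq.1, mul_pos hp.2 hq.2⟩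
  · exact ⟨mul_pos_of_neg_of_neg hp.1 hq.1, mul_pos hp.2 hq.2⟩
  · exact ⟨mul_pos hp.1 hq.1, mul_pos_of_neg_of_neg hp.2 hq.2⟩
  · exact ⟨mul_pos_of_neg_of_neg hp.1 hq.1, mul_pos_of_neg_of_neg hp.2 hq.2⟩

theorem ne_zero_of_mem_region {i : Fin 4} {p : Brill} (hp : p ∈ region i) :
    lam p ≠ 0 ∧ cosTwoKy p ≠ 0 := by
  have h := mul_pos_of_mem_region hp hp
  exact ⟨left_ne_zero_of_mul h.1.ne', left_ne_zero_of_mul h.2.ne'⟩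

/-! ### The diffeomorphism on each region -/

/-- The sphere equation recovers `λ²` from `n`, and the region fixes the sign of `λ`. -/
theorem injOn_nMap_region (i : Fin 4) : InjOn nMap (region i) := by
  intro p hp q hq h
  obtain ⟨h1, h2⟩ := mul_pos_of_mem_region hp hq
  obtain ⟨k, rfl⟩ := toBrill_surjective p
  obtain ⟨k', rfl⟩ := toBrill_surjective q
  simp only [nMap_toBrill, lam_toBrill, cosTwoKy_toBrill] at h h1 h2
  have e1 := lamFun_sq_add k
  have e2 := lamFun_sq_add k'
  rw [h] at e1
  refine toBrill_eq_of_lamFun_eq ?_ h h2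
  rcases sq_eq_sq_iff_eq_or_eq_neg.1 (show lamFun k ^ 2 = lamFun k' ^ 2 by linarith) with h3 | h3
  · exact h3
  · rw [h3] at h1
    nlinarith [sq_nonneg (lamFun k')]

/-- By continuity a local section of `n` through a point of the region stays in the region. -/
theorem isOpen_image_nMap_region (i : Fin 4) : IsOpen (nMap '' region i) := by
  rw [isOpen_iff_mem_nhds]
  rintro _ ⟨p, hp, rfl⟩
  obtain ⟨hl, hc⟩ := ne_zero_of_mem_region hp
  obtain ⟨k, rfl⟩ := toBrill_surjective p
  obtain ⟨g, hg, hgk, hright⟩ := exists_local_section hl hc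
  have hmem : ∀ᶠ w in 𝓝 (nFun k), g w ∈ region i :=
    hg.continuousAt ((region i).isOpen.mem_nhds (by rwa [hgk]))
  filter_upwards [hmem, hright] with w h1 h2 using ⟨g w, h1, h2⟩

/-- On each region the map `n` is a diffeomorphism onto its open image. -/
theorem exists_diffeomorph_region (i : Fin 4) :
    ∃ V : TopologicalSpace.Opens E3, (V : Set E3) = nMap '' region i ∧
      ∃ Φ : Diffeomorph 𝓘(ℝ, E3) 𝓘(ℝ, E3) (region i) V ∞, ∀ k, (Φ k : E3) = nMap k := by
  let V : TopologicalSpace.Opens E3 := ⟨nMap '' region i, isOpen_image_nMap_region i⟩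
  let e : region i ≃ V := (injOn_nMap_region i).bijOn_image.equiv nMap
  have he : ∀ k, (e k : E3) = nMap k := fun k => rfl
  refine ⟨V, rfl, ⟨e, ?_, ?_⟩, he⟩
  · rw [← ContMDiff.subtypeVal_comp_iff]
    exact contMDiff_nMap.comp contMDiff_subtype_val
  · intro w
    obtain ⟨p, rfl⟩ := e.surjective w
    obtain ⟨hl, hc⟩ := ne_zero_of_mem_region p.2
    obtain ⟨k, hk⟩ := toBrill_surjective p.1
    rw [← hk] at hl hc
    obtain ⟨g, hg, hgk, hright⟩ := exists_local_section hl hc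
    have hek : (e p : E3) = nFun k := by rw [he, ← hk, nMap_toBrill]
    rw [← ContMDiffAt.subtypeVal_comp_iff]
    rw [← hek] at hg hright hgk
    refine (contMDiffAt_subtype_iff.2 hg).congr_of_eventuallyEq ?_
    have hmem : ∀ᶠ w in 𝓝 (e p : E3), g w ∈ region i :=
      hg.continuousAt ((region i).isOpen.mem_nhds (by rw [hgk, hk]; exact p.2))
    filter_upwards [continuous_subtype_val.continuousAt.eventually hmem,
      continuous_subtype_val.continuousAt.eventually hright] with w h1 h2
    -- Injectivity forces the inverse to coincide with the smooth local section near this point.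
    refine injOn_nMap_region i (e.symm w).2 h1 ?_
    rw [h2, ← he, e.apply_symm_apply]

/-! ### The image of region 0 -/

/-- The first polar component vanishes only where `cos (2 ky)` does. -/
theorem cosTwoKyFun_eq_zero_of_add {k : E3} (h1 : lamFun k + nFun k 1 = 0)
    (h2 : nFun k 0 + nFun k 2 = 0) : cosTwoKyFun k = 0 := by
  rw [lamFun_add_nFun_one] at h1
  rw [nFun_zero_add_two] at h2
  rw [cosTwoKyFun_eq_mul]
  generalize Real.cos (k 1) - Real.sin (k 1) = B
  linear_combination B * (Real.cos (k 0 + k 2) * h1 + Real.sin (k 0 + k 2) * h2)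
    - B * (Real.cos (k 1) + Real.sin (k 1)) * Real.sin_sq_add_cos_sq (k 0 + k 2)

/-- The second polar component vanishes only where `cos (2 ky)` does. -/
theorem cosTwoKyFun_eq_zero_of_sub {k : E3} (h1 : lamFun k - nFun k 1 = 0)
    (h2 : nFun k 0 - nFun k 2 = 0) : cosTwoKyFun k = 0 := by
  rw [lamFun_sub_nFun_one] at h1
  rw [nFun_zero_sub_two] at h2
  rw [cosTwoKyFun_eq_mul]
  generalize Real.cos (k 1) + Real.sin (k 1) = A
  linear_combination A * (Real.cos (k 0 - k 2) * h1 + Real.sin (k 0 - k 2) * h2)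
    - A * (Real.cos (k 1) - Real.sin (k 1)) * Real.sin_sq_add_cos_sq (k 0 - k 2)

theorem cosTwoKyFun_pos {k : E3} (h : |k 1| < Real.pi / 4) : 0 < cosTwoKyFun k := by
  rw [abs_lt] at h
  exact Real.cos_pos_of_mem_Ioo ⟨by linarith, by linarith⟩

theorem nMap_image_region_zero : nMap '' region 0 = Qa := by
  ext w
  rw [mem_Qa_iff]
  constructor
  · rintro ⟨p, hp, rfl⟩
    obtain ⟨k, rfl⟩ := toBrill_surjective p
    have hl : 0 < lamFun k := hp.1
    have hc : cosTwoKyFun k ≠ 0 := hp.2.ne'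
    have hs := lamFun_sq_add k
    rw [nMap_toBrill]
    refine ⟨by nlinarith, ?_⟩
    rintro (⟨h1, h2, h3⟩ | ⟨h1, h2, h3⟩)
    · refine hc (cosTwoKyFun_eq_zero_of_sub ?_ (sub_eq_zero.2 h1))
      rw [← h1] at hs
      -- On this arch the sphere equation reads `λ² + n₁² + 2n₀² = 1`, while `2n₀² + 2n₁² = 1`;
      -- hence `λ² = n₁²`, and positivity selects `λ = n₁`, so `V = 0`.
      have : (lamFun k - nFun k 1) * (lamFun k + nFun k 1) = 0 := by
        linear_combination hs - 2 * h3
      exact (mul_eq_zero.1 this).resolve_right (by linarith)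
    · refine hc (cosTwoKyFun_eq_zero_of_add ?_ (by linarith))
      have h1' : nFun k 2 = -nFun k 0 := by linarith
      rw [h1'] at hs
      have : (lamFun k + nFun k 1) * (lamFun k - nFun k 1) = 0 := by
        linear_combination hs - 2 * h3
      exact (mul_eq_zero.1 this).resolve_right (by linarith)
  · rintro ⟨hball, harch⟩
    have hpos : 0 < 1 - (w 0 ^ 2 + w 1 ^ 2 + w 2 ^ 2) := by linarith
    set l := √(1 - (w 0 ^ 2 + w 1 ^ 2 + w 2 ^ 2)) with hl
    have hl0 : 0 < l := Real.sqrt_pos.2 hpos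
    have hl2 : l ^ 2 = 1 - (w 0 ^ 2 + w 1 ^ 2 + w 2 ^ 2) := Real.sq_sqrt hpos.le
    clear_value l
    -- Lift `w` to the hemisphere `λ > 0`. There `U = 0` would put `w` on `e₋(T₂)` and `V = 0` on
    -- `e₊(T₁)`.
    obtain ⟨k, hkl, hkn, hk1, -, -⟩ := exists_lamFun_eq_nFun_eq (l := l) (w := w) (by linarith)
      (by
        rintro ⟨h1, h2⟩
        have e1 : w 1 = -l := by linarith
        have e2 : w 2 = -w 0 := by linarith
        rw [e1, e2] at hl2
        exact harch (Or.inr ⟨by linarith, by linarith, by rw [e1]; linarith⟩))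
      (by
        rintro ⟨h1, h2⟩
        have e1 : w 1 = l := by linarith
        have e2 : w 2 = w 0 := by linarith
        rw [e1, e2] at hl2
        exact harch (Or.inl ⟨by linarith, by linarith, by rw [e1]; linarith⟩))
    exact ⟨toBrill k, ⟨by rwa [lam_toBrill, hkl], cosTwoKyFun_pos hk1⟩, hkn⟩

/-! ### Symmetries -/

/-- A continuous self-map of `ℝ³` that is, modulo the reciprocal lattice, well defined and
involutive induces a continuous involution of the Brillouin zone. -/
theorem exists_induced_involution {f : E3 → E3} (hf : Continuous f)
    (hL : ∀ k k', k' - k ∈ reciprocalLattice → f k' - f k ∈ reciprocalLattice)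
    (hi : ∀ k, f (f k) - k ∈ reciprocalLattice) :
    ∃ F : Brill → Brill, Continuous F ∧ Function.Involutive F ∧
      ∀ k, F (toBrill k) = toBrill (f k) := by
  let F : Brill → Brill := Quotient.lift (toBrill ∘ f) fun _ _ h =>
    toBrill_eq_iff.2 (hL _ _ (toBrill_eq_iff.1 (Quotient.sound h)))
  have hF : ∀ k, F (toBrill k) = toBrill (f k) := fun _ => rfl
  refine ⟨F, Continuous.quotient_lift (isLocalHomeomorph_toBrill.continuous.comp hf) _, ?_, hF⟩
  intro p
  obtain ⟨k, rfl⟩ := toBrill_surjective p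
  rw [hF, hF]
  exact (toBrill_eq_iff.2 (hi k)).symm

/-- The involution `kx ↦ kx + π` changes the signs of `λ` and `n`. -/
theorem exists_involution_neg : ∃ F : Brill → Brill, Continuous F ∧ Function.Involutive F ∧
    ∀ p, lam (F p) = -lam p ∧ nMap (F p) = -nMap p ∧ cosTwoKy (F p) = cosTwoKy p := by
  obtain ⟨F, hF, hi, hk⟩ := exists_induced_involution (f := fun k => k + !₂[Real.pi, 0, 0])
    (by fun_prop) (fun k k' h => by simpa using h)
    (fun k => ⟨![2, 0, 0], by decide, fun i => by fin_cases i <;> simp; ring⟩)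
  refine ⟨F, hF, hi, fun p => ?_⟩
  obtain ⟨k, rfl⟩ := toBrill_surjective p
  rw [hk]
  simp only [lam_toBrill, nMap_toBrill, cosTwoKy_toBrill]
  refine ⟨?_, ?_, ?_⟩
  · simp [lamFun]
    ring
  · ext i
    fin_cases i <;> simp [nFun] <;> ring
  · simp [cosTwoKyFun]

/-- The involution `(kx, ky, kz) ↦ (kx + π/2, π/2 - ky, kz - π/2)` preserves `λ` and `n` and
changes the sign of `cos (2 ky)`. -/
theorem exists_involution_flip : ∃ F : Brill → Brill, Continuous F ∧ Function.Involutive F ∧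
    ∀ p, lam (F p) = lam p ∧ nMap (F p) = nMap p ∧ cosTwoKy (F p) = -cosTwoKy p := by
  obtain ⟨F, hF, hi, hk⟩ := exists_induced_involution
    (f := fun k => !₂[k 0 + Real.pi / 2, Real.pi / 2 - k 1, k 2 - Real.pi / 2])
    (by fun_prop)
    (by
      rintro k k' ⟨m, ⟨r, hr⟩, hm⟩
      have h0 := hm 0
      have h1 := hm 1
      have h2 := hm 2
      simp only [PiLp.sub_apply] at h0 h1 h2
      refine ⟨![m 0, -m 1, m 2], ⟨r - m 1, ?_⟩, fun i => ?_⟩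
      · simp
        omega
      · fin_cases i <;> simp <;> linarith)
    -- Applied twice, the map is translation by `(π, 0, -π)`, a lattice vector.
    (fun k => ⟨![1, 0, -1], by decide, fun i => by fin_cases i <;> simp <;> ring⟩)
  refine ⟨F, hF, hi, fun p => ?_⟩
  obtain ⟨k, rfl⟩ := toBrill_surjective p
  rw [hk]
  simp only [lam_toBrill, nMap_toBrill, cosTwoKy_toBrill]
  refine ⟨?_, ?_, ?_⟩
  · simp [lamFun, Real.cos_add_pi_div_two, Real.sin_add_pi_div_two, Real.cos_sub_pi_div_two,
      Real.sin_sub_pi_div_two, Real.cos_pi_div_two_sub, Real.sin_pi_div_two_sub]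
    ring
  · ext i
    fin_cases i <;> simp [nFun, Real.cos_add_pi_div_two, Real.sin_add_pi_div_two,
      Real.cos_sub_pi_div_two, Real.sin_sub_pi_div_two, Real.cos_pi_div_two_sub,
      Real.sin_pi_div_two_sub] <;> ring
  · simp [cosTwoKyFun, mul_sub, mul_div_cancel₀, Real.cos_pi_sub]

/-! ### Connectedness of region 0 -/

theorem two_mul_lamFun (k : E3) : 2 * lamFun k =
    (Real.cos (k 1) + Real.sin (k 1)) * Real.cos (k 0 + k 2)
      + (Real.cos (k 1) - Real.sin (k 1)) * Real.cos (k 0 - k 2) := by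
  rw [← lamFun_add_nFun_one, ← lamFun_sub_nFun_one]
  ring

/-- Cosine is even and decreasing on `[0, π]`; this is what the bounds `|kx ± kz| ≤ π` of the box
are for. -/
theorem cos_le_cos_mul {x t : ℝ} (hx : |x| ≤ Real.pi) (ht : t ∈ Icc (0 : ℝ) 1) :
    Real.cos x ≤ Real.cos (t * x) := by
  rw [← Real.cos_abs x, ← Real.cos_abs (t * x), abs_mul, abs_of_nonneg ht.1]
  exact Real.cos_le_cos_of_nonneg_of_le_pi (mul_nonneg ht.1 (abs_nonneg x)) hx
    (mul_le_of_le_one_left (abs_nonneg x) ht.2)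

theorem cos_add_sin_pos {y : ℝ} (h : |y| < Real.pi / 4) :
    0 < Real.cos y + Real.sin y ∧ 0 < Real.cos y - Real.sin y := by
  rw [abs_lt] at h
  have hc : 0 < Real.cos y := Real.cos_pos_of_mem_Ioo ⟨by linarith [Real.pi_pos],
    by linarith [Real.pi_pos]⟩
  have h2 : 0 < Real.cos (2 * y) := Real.cos_pos_of_mem_Ioo ⟨by linarith, by linarith⟩
  rw [Real.cos_two_mul'] at h2
  have := abs_lt.1 (abs_lt_of_sq_lt_sq (show Real.sin y ^ 2 < Real.cos y ^ 2 by linarith) hc.le)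
  constructor <;> linarith

/-- Shrinking `kx` and `kz` to zero inside the box increases `λ`. -/
theorem lamFun_le_lamFun_shrink {k : E3} (h1 : |k 1| < Real.pi / 4) (hp : |k 0 + k 2| ≤ Real.pi)
    (hq : |k 0 - k 2| ≤ Real.pi) {t : ℝ} (ht : t ∈ Icc (0 : ℝ) 1) :
    lamFun k ≤ lamFun !₂[t * k 0, k 1, t * k 2] := by
  obtain ⟨hA, hB⟩ := cos_add_sin_pos h1
  have e1 := two_mul_lamFun k
  have e2 := two_mul_lamFun !₂[t * k 0, k 1, t * k 2]
  simp [← mul_add, ← mul_sub] at e2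
  have := mul_le_mul_of_nonneg_left (cos_le_cos_mul hp ht) hA.le
  have := mul_le_mul_of_nonneg_left (cos_le_cos_mul hq ht) hB.le
  linarith

/-- Each point is joined to the origin inside the region: first shrink `kx` and `kz`, which cannot
lower `λ`, then shrink `ky`, along which `λ = cos ky > 0`. -/
theorem isPreconnected_region_zero : IsPreconnected (region 0 : Set Brill) := by
  refine isPreconnected_of_forall (toBrill 0) fun p hp => ?_
  obtain ⟨k₀, rfl⟩ := toBrill_surjective p
  have hc₀ : 0 < cosTwoKyFun k₀ := hp.2
  -- Realizing the same `(λ, n)` inside the box gives, by injectivity, a representative of the same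
  -- class there.
  obtain ⟨k, hkl, hkn, h1, h02, h02'⟩ := exists_lamFun_eq_nFun_eq (lamFun_sq_add k₀)
    (fun h => hc₀.ne' (cosTwoKyFun_eq_zero_of_add h.1 h.2))
    (fun h => hc₀.ne' (cosTwoKyFun_eq_zero_of_sub h.1 h.2))
  have hkk : toBrill k = toBrill k₀ :=
    toBrill_eq_of_lamFun_eq hkl hkn (mul_pos (cosTwoKyFun_pos h1) hc₀)
  have hlk : 0 < lamFun k := by rw [hkl]; exact hp.1
  rw [← hkk]
  have hcont := isLocalHomeomorph_toBrill.continuous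
  let γ : ℝ → Brill := fun t => toBrill !₂[t * k 0, k 1, t * k 2]
  let δ : ℝ → Brill := fun t => toBrill !₂[0, t * k 1, 0]
  have hγ : IsPreconnected (γ '' Icc 0 1) :=
    isPreconnected_Icc.image γ (hcont.comp (by fun_prop)).continuousOn
  have hδ : IsPreconnected (δ '' Icc 0 1) :=
    isPreconnected_Icc.image δ (hcont.comp (by fun_prop)).continuousOn
  have hz : (0 : ℝ) ∈ Icc (0 : ℝ) 1 := by simp
  have ho : (1 : ℝ) ∈ Icc (0 : ℝ) 1 := by simp
  refine ⟨γ '' Icc 0 1 ∪ δ '' Icc 0 1, union_subset ?_ ?_, Or.inr ⟨0, hz, ?_⟩,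
    Or.inl ⟨1, ho, ?_⟩, hγ.union (γ 0) ⟨0, hz, rfl⟩ ⟨1, ho, by simp [γ, δ]⟩ hδ⟩
  · rintro _ ⟨t, ht, rfl⟩
    exact ⟨hlk.trans_le (lamFun_le_lamFun_shrink h1 h02 h02' ht), cosTwoKyFun_pos (by simpa using h1)⟩
  · rintro _ ⟨t, ht, rfl⟩
    have htk : |t * k 1| < Real.pi / 4 := by
      rw [abs_mul, abs_of_nonneg ht.1]
      exact (mul_le_of_le_one_left (abs_nonneg _) ht.2).trans_lt h1
    refine ⟨?_, cosTwoKyFun_pos (by simpa using htk)⟩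
    have := abs_lt.1 htk
    change 0 < lamFun _
    simpa [lamFun] using Real.cos_pos_of_mem_Ioo (x := t * k 1)
      ⟨by linarith [Real.pi_pos], by linarith [Real.pi_pos]⟩
  · refine congrArg toBrill ?_
    ext i
    fin_cases i <;> simp
  · refine congrArg toBrill ?_
    ext i
    fin_cases i <;> simp

/-! ### Transport along the symmetries -/

/-- An involution that exchanges two regions carries one onto the other. -/
theorem image_region_eq {F : Brill → Brill} (hF : Function.Involutive F) {i j : Fin 4}
    (h : ∀ p, F p ∈ region i ↔ p ∈ region j) : F '' region i = region j := by
  rw [hF.image_eq_preimage_symm]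
  ext p
  exact h p

/-- The regions are connected, and the image of each under `n` is the appropriate pierced ball. -/
theorem isConnected_region_and_image :
    (∀ i, IsConnected (region i : Set Brill)) ∧
    nMap '' region 0 = Qa ∧ nMap '' region 2 = Qa ∧
    nMap '' region 1 = Qb ∧ nMap '' region 3 = Qb := by
  obtain ⟨F, hF, hFi, hFp⟩ := exists_involution_neg
  obtain ⟨G, hG, hGi, hGp⟩ := exists_involution_flip
  have r1 : F '' region 0 = region 1 := image_region_eq hFi fun p => by
    rw [mem_region_zero, mem_region_one, (hFp p).1, (hFp p).2.2, neg_pos]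
  have r2 : G '' region 0 = region 2 := image_region_eq hGi fun p => by
    rw [mem_region_zero, mem_region_two, (hGp p).1, (hGp p).2.2, neg_pos]
  have r3 : G '' region 1 = region 3 := image_region_eq hGi fun p => by
    rw [mem_region_one, mem_region_three, (hGp p).1, (hGp p).2.2, neg_pos]
  have c0 : IsConnected (region 0 : Set Brill) := by
    refine ⟨⟨toBrill 0, ?_⟩, isPreconnected_region_zero⟩
    change 0 < lamFun 0 ∧ 0 < cosTwoKyFun 0
    simp [lamFun, cosTwoKyFun]
  have c1 : IsConnected (region 1 : Set Brill) := r1 ▸ c0.image F hF.continuousOn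
  have c2 : IsConnected (region 2 : Set Brill) := r2 ▸ c0.image G hG.continuousOn
  have c3 : IsConnected (region 3 : Set Brill) := r3 ▸ c1.image G hG.continuousOn
  have n0 := nMap_image_region_zero
  have hGn : nMap ∘ G = nMap := funext fun p => (hGp p).2.1
  have n1 : nMap '' region 1 = Qb := by
    ext w
    rw [← neg_mem_Qa_iff, ← n0, ← r1, image_image]
    simp only [mem_image, (hFp _).2.1, neg_eq_iff_eq_neg]
  refine ⟨fun i => ?_, n0, ?_, n1, ?_⟩
  · fin_cases i
    exacts [c0, c1, c2, c3]
  · rw [← r2, ← image_comp, hGn, n0]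
  · rw [← r3, ← image_comp, hGn, n1]

/-! ### The connected components -/

theorem exists_mem_region {p : Brill} (hp : p ∈ singularSetᶜ) : ∃ i, p ∈ region i := by
  simp only [singularSet, mem_compl_iff, mem_union, mem_ofPred_eq, not_or] at hp
  rcases lt_or_gt_of_ne hp.1 with h1 | h1 <;> rcases lt_or_gt_of_ne hp.2 with h2 | h2
  · exact ⟨3, h1, h2⟩
  · exact ⟨1, h1, h2⟩
  · exact ⟨2, h1, h2⟩
  · exact ⟨0, h1, h2⟩

theorem region_subset_compl_singularSet (i : Fin 4) : (region i : Set Brill) ⊆ singularSetᶜ :=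
  fun _ hp h => h.elim (ne_zero_of_mem_region hp).1 (ne_zero_of_mem_region hp).2

theorem eq_of_mem_region {i j : Fin 4} {p : Brill} (hi : p ∈ region i) (hj : p ∈ region j) :
    i = j := by
  fin_cases i <;> fin_cases j <;> first
    | rfl
    | exact absurd hi.1 (not_lt.2 hj.1.le)
    | exact absurd hi.2 (not_lt.2 hj.2.le)

/-- The regions are connected, open, disjoint and cover the complement, so a preconnected subset
meeting one of them cannot leave it. -/
theorem connectedComponentIn_compl_singularSet {i : Fin 4} {p : Brill} (hp : p ∈ region i) :
    connectedComponentIn singularSetᶜ p = region i := by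
  have hps := region_subset_compl_singularSet i hp
  refine Subset.antisymm ?_ ((isConnected_region_and_image.1 i).isPreconnected
    |>.subset_connectedComponentIn hp (region_subset_compl_singularSet i))
  refine isPreconnected_connectedComponentIn.subset_left_of_subset_union (region i).isOpen
    (isOpen_iUnion fun j : {j // j ≠ i} => (region j).isOpen) ?_ ?_
    ⟨p, mem_connectedComponentIn hps, hp⟩
  · rw [disjoint_iUnion_right]
    exact fun j => disjoint_left.2 fun q hq hq' => j.2 (eq_of_mem_region hq' hq)
  · intro q hq
    obtain ⟨j, hj⟩ := exists_mem_region (connectedComponentIn_subset _ _ hq)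
    by_cases hji : j = i
    · exact Or.inl (hji ▸ hj)
    · exact Or.inr (mem_iUnion.2 ⟨⟨j, hji⟩, hj⟩)

end WeylWalk

open WeylWalk in
theorem lemma1 :
    -- the connected components of the complement of the singular set are the four regions
    {C : Set Brill | ∃ p ∈ singularSetᶜ, C = connectedComponentIn singularSetᶜ p}
        = Set.range (fun i => (region i : Set Brill)) ∧
    Function.Injective region ∧
    -- on each region, `n` is a diffeomorphism onto its image
    (∀ i, ∃ V : TopologicalSpace.Opens E3, (V : Set E3) = nMap '' region i ∧
      ∃ Φ : Diffeomorph 𝓘(ℝ, E3) 𝓘(ℝ, E3) (region i) V ∞, ∀ k, (Φ k : E3) = nMap k) ∧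
    nMap '' region 0 = Qa ∧ nMap '' region 2 = Qa ∧
    nMap '' region 1 = Qb ∧ nMap '' region 3 = Qb := by
  obtain ⟨hconn, himage⟩ := isConnected_region_and_image
  refine ⟨?_, ?_, exists_diffeomorph_region, himage⟩
  · ext C
    constructor
    · rintro ⟨p, hp, rfl⟩
      obtain ⟨i, hi⟩ := exists_mem_region hp
      exact ⟨i, (connectedComponentIn_compl_singularSet hi).symm⟩
    · rintro ⟨i, rfl⟩
      obtain ⟨p, hp⟩ := (hconn i).nonempty
      exact ⟨p, region_subset_compl_singularSet i hp,
        (connectedComponentIn_compl_singularSet hp).symm⟩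
  · intro i j hij
    obtain ⟨p, hp⟩ := (hconn i).nonempty
    exact eq_of_mem_region hp (hij ▸ hp)
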